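/- Let $T>0$, and let $X=(X_t)_{t\in[0,T]}$ be a centered Gaussian process with $\sup_{t\in[0,T]}\mathbb{E}[X_t^2]<\infty$ on a probability space $(\Omega,\mathcal{F},\mathbb{P})$. Suppose that there are a standard Brownian motion $W=(W_t)_{t\in[0,T]}$ on this space and a deterministic kernel $K\in L^2([0,T]^2)$, with $K(t,\cdot)\in L^2([0,T])$ for every $t\in[0,T]$, such that for every $t\in[0,T]$, almost surely, $$X_t=\int_0^T K(t,s)\,dW_s ,$$ where the integral is the Wiener integral, i.e. the value at $K(t,\cdot)$ of the continuous linear extension to $L^2([0,T])\to L^2(\Omega)$ of the map $\mathbf 1_{[0,u)}\mapsto W_u$, $u\in[0,T]$. For $t\in[0,T]$ let $H^X_t$ denote the closure in $L^2(\Omega)$ of the linear span of $\{X_s: s\in[0,t]\}$, and define $H^W_t$ likewise from $W$. Suppose that $H^X_t=H^W_t$ for all $t\in[0,T]$. Let $0<t_U<T$, $\Delta=[0,t_U]$ and $\mathcal{F}_\Delta=\sigma(X_s: s\in\Delta)$. Then for every $t\in(t_U,T]$, almost surely, $$\mathbb{E}[X_t\mid\mathcal{F}_\Delta]=\int_0^{t_U}K(t,s)\,dW_s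 ,$$ where $\int_0^{t_U}K(t,s)\,dW_s=\int_0^T\mathbf 1_{[0,t_U]}(s)K(t,s)\,dW_s$. -/

import Mathlib

open MeasureTheory ProbabilityTheory
open scoped ENNReal

noncomputable section

variable {Ω : Type*} {mΩ : MeasurableSpace Ω} {T : ℝ}

/-- Lebesgue measure on `[0,T]`; `Lp ℝ 2 (intervalMeasure T)` is `L²([0,T])`. -/
abbrev intervalMeasure (T : ℝ) : Measure ℝ := volume.restrict (Set.Icc 0 T)

/-- `W = (W_t)_{t ∈ [0,T]}` is a standard Brownian motion on `[0,T]`: a centered Gaussian process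
with covariance `min s t` and almost surely continuous paths. -/
structure IsBrownianMotionOn (W : Set.Icc (0 : ℝ) T → Ω → ℝ) (P : Measure Ω) : Prop where
  isGaussianProcess : IsGaussianProcess W P
  centered : ∀ t, ∫ ω, W t ω ∂P = 0
  covariance_eq : ∀ s t, cov[W s, W t; P] = min (s : ℝ) (t : ℝ)
  continuous_paths : ∀ᵐ ω ∂P, Continuous fun t => W t ω

namespace IsBrownianMotionOn

variable {W : Set.Icc (0 : ℝ) T → Ω → ℝ} {P : Measure Ω}

lemma memLp_two (hW : IsBrownianMotionOn W P) (t : Set.Icc (0 : ℝ) T) : MemLp (W t) 2 P :=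
  (hW.isGaussianProcess.hasGaussianLaw_eval t).memLp_two

/-- The Wiener integral `f ↦ ∫_0^T f(s) dW_s` as a map `L²([0,T]) → L²(Ω)`: the continuous linear
extension of `∑ i, a i • 𝟏_[0,t_i) ↦ ∑ i, a i • W_{t_i}`. -/
def wienerIntegral (hW : IsBrownianMotionOn W P) :
    Lp ℝ 2 (intervalMeasure T) →L[ℝ] Lp ℝ 2 P :=
  (Finsupp.linearCombination ℝ fun t : Set.Icc (0 : ℝ) T =>
      (hW.memLp_two t).toLp (W t)).extendOfNorm
    (Finsupp.linearCombination ℝ fun t : Set.Icc (0 : ℝ) T =>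
      indicatorConstLp 2 (μ := intervalMeasure T) (measurableSet_Ico (a := (0 : ℝ)) (b := (t : ℝ)))
        (measure_ne_top _ _) (1 : ℝ))

/-- The Wiener integral `∫_0^u f(s) dW_s = ∫_0^T 𝟏_[0,u](s) f(s) dW_s`, for `f ∈ L²([0,T])`. -/
def wienerIntegralUpTo (hW : IsBrownianMotionOn W P) (u : Set.Icc (0 : ℝ) T) (f : ℝ → ℝ)
    (hf : MemLp f 2 (intervalMeasure T)) : Lp ℝ 2 P :=
  hW.wienerIntegral ((hf.indicator (measurableSet_Icc (a := (0 : ℝ)) (b := (u : ℝ)))).toLp _)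

end IsBrownianMotionOn

/-- The first chaos `H^X_t`: the closure in `L²(Ω)` of the linear span of `X_s`, `s ∈ [0,t]`. -/
def firstChaos (X : Set.Icc (0 : ℝ) T → Ω → ℝ) (P : Measure Ω) (t : Set.Icc (0 : ℝ) T) :
    Submodule ℝ (Lp ℝ 2 P) :=
  (Submodule.span ℝ {ξ : Lp ℝ 2 P | ∃ s ≤ t, ξ =ᵐ[P] X s}).topologicalClosure

/-- The σ-algebra `σ(X_s : s ∈ [0,u])`. -/
abbrev sigmaUpTo (X : Set.Icc (0 : ℝ) T → Ω → ℝ) (u : Set.Icc (0 : ℝ) T) : MeasurableSpace Ω :=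
  ⨆ s ∈ Set.Iic u, MeasurableSpace.comap (X s) inferInstance

end

/-! Write X_t = ξ + η with ξ = ∫_0^{t_U} K(t,s) dW_s. Then ξ lies in H^W at t_U, hence in H^X at
t_U, so it is almost surely equal to an F_Δ-measurable variable
(`aestronglyMeasurable_of_mem_firstChaos`). By the Wiener isometry, η is orthogonal to that same
space (`inner_wienerIntegral_sub_eq_zero`). Moreover η = X_t - ξ lies in the Gaussian space H^X_t,
where orthogonality is independence, so η is independent of F_Δ and E[η | F_Δ] = E[η] = 0
(`condExp_sigmaUpTo_eq_zero`). -/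

noncomputable section

variable {Ω : Type*} {mΩ : MeasurableSpace Ω} {T : ℝ}

/-! ### Gaussian subspaces of L²(Ω): closure and independence. -/

section GaussianSubspace

variable {P : Measure Ω}

lemma integral_eq_inner_indicatorConstLp_univ [IsProbabilityMeasure P] (ξ : Lp ℝ 2 P) :
    ∫ ω, ξ ω ∂P =
      inner ℝ (indicatorConstLp 2 MeasurableSet.univ (measure_ne_top P _) (1 : ℝ)) ξ := by
  rw [L2.inner_indicatorConstLp_one, setIntegral_univ]

lemma continuous_integral_Lp_two [IsProbabilityMeasure P] :
    Continuous fun ξ : Lp ℝ 2 P => ∫ ω, ξ ω ∂P := by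
  simp_rw [integral_eq_inner_indicatorConstLp_univ]
  fun_prop

lemma norm_sq_Lp_two (ξ : Lp ℝ 2 P) : ‖ξ‖ ^ 2 = ∫ ω, ξ ω ^ 2 ∂P := by
  rw [← real_inner_self_eq_norm_sq, L2.inner_def]
  simp [pow_two]

lemma integral_norm_le_norm_Lp_two [IsProbabilityMeasure P] (ξ : Lp ℝ 2 P) :
    ∫ ω, ‖ξ ω‖ ∂P ≤ ‖ξ‖ := by
  rw [integral_norm_eq_lintegral_enorm (Lp.aestronglyMeasurable ξ), Lp.norm_def,
    ← eLpNorm_one_eq_lintegral_enorm]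
  exact ENNReal.toReal_mono (Lp.eLpNorm_ne_top ξ)
    (eLpNorm_le_eLpNorm_of_exponent_le (by norm_num) (Lp.aestronglyMeasurable ξ))

lemma norm_cexp_sub_cexp_le (x y : ℝ) :
    ‖Complex.exp (x * Complex.I) - Complex.exp (y * Complex.I)‖ ≤ ‖x - y‖ := by
  have h : Complex.exp (x * Complex.I) - Complex.exp (y * Complex.I)
      = Complex.exp (y * Complex.I) * (Complex.exp (Complex.I * ((x - y : ℝ) : ℂ)) - 1) := by
    rw [mul_sub, ← Complex.exp_add, mul_one]
    congr 2
    push_cast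
    ring
  rw [h, norm_mul, Complex.norm_exp_ofReal_mul_I, one_mul]
  exact Real.norm_exp_I_mul_ofReal_sub_one_le

lemma integrable_cexp_mul_I [IsProbabilityMeasure P] {f : Ω → ℝ} (hf : AEStronglyMeasurable f P) :
    Integrable (fun ω => Complex.exp (f ω * Complex.I)) P := by
  refine Integrable.of_bound (C := 1) ?_ (.of_forall fun ω => ?_)
  · exact (by fun_prop :
      Continuous fun x : ℝ => Complex.exp (x * Complex.I)).comp_aestronglyMeasurable hf
  · rw [Complex.norm_exp_ofReal_mul_I]

/-- The map is 1-Lipschitz, since |e^{ix} - e^{iy}| ≤ |x - y| and the L¹ norm is at most the L²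
norm. This carries characteristic functions to L² limits. -/
lemma continuous_integral_cexp_Lp_two [IsProbabilityMeasure P] :
    Continuous fun ξ : Lp ℝ 2 P => ∫ ω, Complex.exp (ξ ω * Complex.I) ∂P := by
  refine LipschitzWith.continuous (K := 1) (LipschitzWith.of_dist_le_mul fun ξ η => ?_)
  rw [dist_eq_norm, dist_eq_norm, NNReal.coe_one, one_mul,
    ← integral_sub (integrable_cexp_mul_I (Lp.aestronglyMeasurable ξ))
      (integrable_cexp_mul_I (Lp.aestronglyMeasurable η))]
  refine le_trans ?_ (integral_norm_le_norm_Lp_two (ξ - η))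
  refine norm_integral_le_of_norm_le ((Lp.memLp (ξ - η)).integrable (by norm_num)).norm ?_
  filter_upwards [Lp.coeFn_sub ξ η] with ω h
  rw [h]
  exact norm_cexp_sub_cexp_le _ _

/-- A subspace of `L²(Ω)` consisting of centered Gaussian random variables. -/
structure IsGaussianSubspace (H : Submodule ℝ (Lp ℝ 2 P)) : Prop where
  hasGaussianLaw : ∀ ξ ∈ H, HasGaussianLaw ξ P
  centered : ∀ ξ ∈ H, ∫ ω, ξ ω ∂P = 0

namespace IsGaussianSubspace

variable {H : Submodule ℝ (Lp ℝ 2 P)}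

/-- Evaluation at frequency 1 suffices because a subspace contains all multiples t • ξ. Both sides
are continuous in ξ, so the identity survives closure. -/
lemma integral_cexp [IsProbabilityMeasure P] (hH : IsGaussianSubspace H)
    {ξ : Lp ℝ 2 P} (hξ : ξ ∈ H) :
    ∫ ω, Complex.exp (ξ ω * Complex.I) ∂P = Complex.exp (-(‖ξ‖ ^ 2 / 2 : ℝ)) := by
  have hG := hH.hasGaussianLaw ξ hξ
  have h := hG.charFun_map_eq 1
  rw [charFun_apply_real, integral_map hG.aemeasurable (by fun_prop)] at h
  simp only [Complex.ofReal_one, one_mul] at h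
  rw [h]
  have h1 : ∀ x : ℝ, inner ℝ (1 : ℝ) x = x := fun x => by simp
  simp_rw [h1]
  rw [hH.centered ξ hξ, variance_eq_integral hG.aemeasurable, hH.centered ξ hξ, norm_sq_Lp_two]
  simp

/-- A random variable in the closure of a centered Gaussian subspace is centered Gaussian. -/
lemma topologicalClosure [IsProbabilityMeasure P] (hH : IsGaussianSubspace H) :
    IsGaussianSubspace H.topologicalClosure := by
  have key : ∀ ξ ∈ H.topologicalClosure,
      ∫ ω, Complex.exp (ξ ω * Complex.I) ∂P = Complex.exp (-(‖ξ‖ ^ 2 / 2 : ℝ)) := fun ξ hξ =>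
    closure_minimal (s := (H : Set (Lp ℝ 2 P)))
      (t := {ξ | ∫ ω, Complex.exp (ξ ω * Complex.I) ∂P = Complex.exp (-(‖ξ‖ ^ 2 / 2 : ℝ))})
      (fun _ h => hH.integral_cexp h)
      (isClosed_eq continuous_integral_cexp_Lp_two (by fun_prop)) hξ
  refine ⟨fun ξ hξ => ⟨?_⟩, fun ξ hξ => ?_⟩
  · have hm : AEMeasurable ξ P := (Lp.aestronglyMeasurable ξ).aemeasurable
    have : IsProbabilityMeasure (P.map ξ) := Measure.isProbabilityMeasure_map hm
    suffices h : P.map ξ = gaussianReal 0 (‖ξ‖₊ ^ 2) by rw [h]; infer_instance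
    refine Measure.ext_of_charFun (funext fun t => ?_)
    rw [charFun_apply_real, integral_map hm (by fun_prop), charFun_gaussianReal]
    have h := key (t • ξ) (Submodule.smul_mem _ t hξ)
    rw [norm_smul] at h
    convert! h using 1
    · refine integral_congr_ae ?_
      filter_upwards [Lp.coeFn_smul t ξ] with ω hω
      simp [hω]
    · congr 1
      have : (‖t‖ ^ 2 : ℝ) = t ^ 2 := by simp
      rw [mul_pow, this]
      push_cast
      simp
      ring
  · exact closure_minimal (s := (H : Set (Lp ℝ 2 P))) (t := {ξ | ∫ ω, ξ ω ∂P = 0})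
      (fun _ h => hH.centered _ h) (isClosed_eq continuous_integral_Lp_two continuous_const) hξ

/-- A process whose variables lie in a centered Gaussian subspace is a Gaussian process. -/
lemma isGaussianProcess (hH : IsGaussianSubspace H) {ι : Type*} {Z : ι → Ω → ℝ}
    (hZ : ∀ i, ∃ ξ ∈ H, Z i =ᵐ[P] ξ) : IsGaussianProcess Z P := by
  choose ξ hξ hZξ using hZ
  have hm : ∀ i, AEMeasurable (Z i) P := fun i =>
    (Lp.aestronglyMeasurable (ξ i)).aemeasurable.congr (hZξ i).symm
  refine ⟨fun I => ⟨isGaussian_of_isGaussian_map fun L => ?_⟩⟩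
  have hr : AEMeasurable (fun ω => I.restrict (Z · ω)) P :=
    aemeasurable_pi_lambda _ fun i => hm i
  rw [AEMeasurable.map_map_of_aemeasurable (by fun_prop) hr]
  classical
  -- A functional L is determined by its values on the coordinate vectors, so L of the finite
  -- marginal is represented by this element of H.
  set η : Lp ℝ 2 P := ∑ i : I, L (Pi.single i 1) • ξ i with hη
  have hηH : η ∈ H := Submodule.sum_mem _ fun i _ => Submodule.smul_mem _ _ (hξ i)
  suffices h : L ∘ (fun ω => I.restrict (Z · ω)) =ᵐ[P] η by
    rw [Measure.map_congr h]
    exact (hH.hasGaussianLaw η hηH).isGaussian_map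
  have hs : ∀ᵐ ω ∂P, ∀ i : I, (L (Pi.single i 1) • ξ i : Lp ℝ 2 P) ω
      = L (Pi.single i 1) * Z i ω := by
    rw [ae_all_iff]
    intro i
    filter_upwards [Lp.coeFn_smul (L (Pi.single i 1)) (ξ i), hZξ i] with ω h1 h2
    rw [h1, h2]
    simp
  filter_upwards [Lp.coeFn_finsetSum Finset.univ (fun i : I => L (Pi.single i 1) • ξ i), hs]
    with ω h1 h2
  rw [hη, h1, Function.comp_apply]
  simp only [Finset.sum_apply, h2]
  conv_lhs => rw [← Finset.univ_sum_single (I.restrict (Z · ω)), map_sum]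
  refine Finset.sum_congr rfl fun i _ => ?_
  have : (Pi.single i (I.restrict (Z · ω) i) : I → ℝ) = Z i ω • Pi.single i 1 := by
    rw [← Pi.single_smul]
    simp
  rw [this, map_smul, smul_eq_mul, mul_comm]

/-- Orthogonal families in a centered Gaussian subspace are independent. -/
lemma indepFun_of_inner_eq_zero [IsProbabilityMeasure P] (hH : IsGaussianSubspace H) {ι κ : Type*}
    {Y : ι → Ω → ℝ} {Z : κ → Ω → ℝ} {η : ι → Lp ℝ 2 P} {ζ : κ → Lp ℝ 2 P}
    (hη : ∀ i, η i ∈ H) (hζ : ∀ j, ζ j ∈ H) (hY : ∀ i, Y i =ᵐ[P] η i) (hZ : ∀ j, Z j =ᵐ[P] ζ j)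
    (h : ∀ i j, inner ℝ (η i) (ζ j) = 0) :
    IndepFun (fun ω i => Y i ω) (fun ω j => Z j ω) P := by
  -- Zero covariance yields independence only for jointly Gaussian families; the common subspace H
  -- supplies the joint law.
  have hG : IsGaussianProcess (Sum.elim Y Z) P := hH.isGaussianProcess fun k => by
    rcases k with i | j
    exacts [⟨η i, hη i, hY i⟩, ⟨ζ j, hζ j, hZ j⟩]
  refine hG.indepFun_of_covariance_eq_zero (fun i => hG.aemeasurable (.inl i))
    (fun j => hG.aemeasurable (.inr j)) fun i j => ?_
  rw [covariance_eq_sub ((Lp.memLp (η i)).ae_eq (hY i).symm)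
    ((Lp.memLp (ζ j)).ae_eq (hZ j).symm), integral_congr_ae (hY i), hH.centered _ (hη i), zero_mul,
    sub_zero, ← h i j, L2.inner_def]
  refine integral_congr_ae ?_
  filter_upwards [hY i, hZ j] with ω h1 h2
  simp [h1, h2, mul_comm]

end IsGaussianSubspace

/-- The linear span of a centered Gaussian process is a Gaussian subspace. -/
lemma isGaussianSubspace_span {ι : Type*} {X : ι → Ω → ℝ}
    (hX : IsGaussianProcess X P) (hX0 : ∀ i, ∫ ω, X i ω ∂P = 0) (S : Set ι) :
    IsGaussianSubspace (Submodule.span ℝ {ξ : Lp ℝ 2 P | ∃ i ∈ S, ξ =ᵐ[P] X i}) := by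
  have hspan : ∀ ξ ∈ Submodule.span ℝ {ξ : Lp ℝ 2 P | ∃ i ∈ S, ξ =ᵐ[P] X i},
      ∃ c : ι →₀ ℝ, ξ =ᵐ[P] fun ω => ∑ i ∈ c.support, c i * X i ω := by
    intro ξ hξ
    have hle : Submodule.span ℝ {ξ : Lp ℝ 2 P | ∃ i ∈ S, ξ =ᵐ[P] X i} ≤
        Submodule.span ℝ (Set.range fun i => (hX.hasGaussianLaw_eval i).memLp_two.toLp (X i)) := by
      refine Submodule.span_mono ?_
      rintro ζ ⟨i, -, hi⟩
      exact ⟨i, Lp.ext ((MemLp.coeFn_toLp _).trans hi.symm)⟩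
    obtain ⟨c, rfl⟩ := Finsupp.mem_span_range_iff_exists_finsupp.1 (hle hξ)
    refine ⟨c, ?_⟩
    have hs : ∀ᵐ ω ∂P, ∀ i ∈ c.support,
        (c i • (hX.hasGaussianLaw_eval i).memLp_two.toLp (X i) : Lp ℝ 2 P) ω = c i * X i ω := by
      rw [Finset.eventually_all]
      intro i _
      filter_upwards [Lp.coeFn_smul (c i) ((hX.hasGaussianLaw_eval i).memLp_two.toLp (X i)),
        (hX.hasGaussianLaw_eval i).memLp_two.coeFn_toLp] with ω h1 h2
      simp [h1, h2]
    filter_upwards [Lp.coeFn_finsetSum c.support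
      (fun i => c i • (hX.hasGaussianLaw_eval i).memLp_two.toLp (X i)), hs] with ω h1 h2
    rw [Finsupp.sum, h1, Finset.sum_apply]
    exact Finset.sum_congr rfl h2
  refine ⟨fun ξ hξ => ?_, fun ξ hξ => ?_⟩
  · obtain ⟨c, hc⟩ := hspan ξ hξ
    exact ((hX.smul c).hasGaussianLaw_fun_sum (I := c.support)).congr hc.symm
  · obtain ⟨c, hc⟩ := hspan ξ hξ
    rw [integral_congr_ae hc, integral_finsetSum _ fun i _ =>
      (hX.hasGaussianLaw_eval i).integrable.const_mul _]
    simp [integral_const_mul, hX0]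

end GaussianSubspace

/-! ### Density of step functions in L²([0,T]). -/

/-- Clamping a to [0,T] loses at most the null point T. This links the intervals [0,t) to the
π-system of half-lines generating the Borel sets. -/
lemma Iio_ae_eq_Ico_projIcc (hT : 0 ≤ T) (a : ℝ) :
    Set.Iio a =ᵐ[intervalMeasure T] Set.Ico 0 (Set.projIcc 0 T hT a : ℝ) := by
  have hne : ∀ᵐ x ∂(intervalMeasure T), x ≠ T :=
    ae_restrict_of_ae (Measure.ae_ne volume T)
  filter_upwards [hne, ae_restrict_mem measurableSet_Icc] with x hx hx'
  have hlt : x < T := lt_of_le_of_ne hx'.2 hx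
  refine propext ?_
  change x < a ↔ 0 ≤ x ∧ x < (Set.projIcc 0 T hT a : ℝ)
  rw [Set.coe_projIcc, lt_max_iff, lt_min_iff]
  constructor
  · exact fun h => ⟨hx'.1, .inr ⟨hlt, h⟩⟩
  · rintro ⟨h0, h | h⟩
    exacts [absurd h0 (not_le.2 h), h.2]

/-- The indicators `𝟏_[0,t)`, `t ∈ [0,T]`, span a dense subspace of `L²([0,T])`. -/
lemma denseRange_linearCombination_indicator (hT : 0 ≤ T) :
    DenseRange (Finsupp.linearCombination ℝ fun t : Set.Icc (0 : ℝ) T =>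
      indicatorConstLp 2 (μ := intervalMeasure T) (measurableSet_Ico (a := (0 : ℝ)) (b := (t : ℝ)))
        (measure_ne_top _ _) (1 : ℝ)) := by
  rw [DenseRange, ← LinearMap.coe_range, Submodule.dense_iff_topologicalClosure_eq_top,
    Submodule.topologicalClosure_eq_top_iff, Finsupp.range_linearCombination, eq_bot_iff]
  intro f hf
  rw [Submodule.mem_bot]
  have hf0 : ∀ t : Set.Icc (0 : ℝ) T, ∫ x in Set.Ico 0 (t : ℝ), f x ∂(intervalMeasure T) = 0 := by
    intro t
    rw [← L2.inner_indicatorConstLp_one (𝕜 := ℝ) measurableSet_Ico (measure_ne_top _ _)]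
    exact (Submodule.mem_orthogonal _ _).1 hf _ (Submodule.subset_span ⟨t, rfl⟩)
  have hint : Integrable f (intervalMeasure T) := (Lp.memLp f).integrable (by norm_num)
  have hIio : ∀ a : ℝ, ∫ x in Set.Iio a, f x ∂(intervalMeasure T) = 0 := fun a => by
    rw [setIntegral_congr_set (Iio_ae_eq_Ico_projIcc hT a), hf0]
  have huniv : ∫ x, f x ∂(intervalMeasure T) = 0 := by
    rw [← hIio (T + 1), ← setIntegral_univ]
    refine setIntegral_congr_set ?_
    filter_upwards [ae_restrict_mem measurableSet_Icc] with x hx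
    exact propext ⟨fun _ => lt_of_le_of_lt hx.2 (lt_add_one T), fun _ => trivial⟩
  refine Lp.ext ((hint.ae_eq_zero_of_forall_setIntegral_eq_zero fun s hs _ => ?_).trans
    (Lp.coeFn_zero ℝ 2 _).symm)
  -- An f orthogonal to every indicator integrates to zero over half-lines, hence over all Borel
  -- sets by the π-λ theorem.
  induction s, hs using MeasurableSpace.induction_on_inter
    ((BorelSpace.measurable_eq (α := ℝ)).trans (borel_eq_generateFrom_Iio ℝ)) isPiSystem_Iio with
  | empty => simp
  | basic s hs =>
    obtain ⟨a, rfl⟩ := hs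
    exact hIio a
  | compl s hs ih =>
    rw [setIntegral_compl hs hint, huniv, ih (measure_lt_top _ _), sub_zero]
  | iUnion g hd hg ih =>
    rw [integral_iUnion hg hd hint.integrableOn]
    simp [fun i => ih i (measure_lt_top _ _)]

/-! ### The Wiener integral. -/

namespace IsBrownianMotionOn

variable {W : Set.Icc (0 : ℝ) T → Ω → ℝ} {P : Measure Ω}

lemma inner_toLp [IsProbabilityMeasure P] (hW : IsBrownianMotionOn W P) (s t : Set.Icc (0 : ℝ) T) :
    inner ℝ ((hW.memLp_two s).toLp (W s)) ((hW.memLp_two t).toLp (W t))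
      = min (s : ℝ) (t : ℝ) := by
  rw [← hW.covariance_eq s t, covariance_eq_sub (hW.memLp_two s) (hW.memLp_two t), hW.centered s,
    zero_mul, sub_zero, L2.inner_def]
  refine integral_congr_ae ?_
  filter_upwards [(hW.memLp_two s).coeFn_toLp, (hW.memLp_two t).coeFn_toLp] with ω h1 h2
  simp [h1, h2, mul_comm]

lemma inner_indicatorConstLp (s t : Set.Icc (0 : ℝ) T) :
    inner ℝ
      (indicatorConstLp 2 (μ := intervalMeasure T) (measurableSet_Ico (a := (0 : ℝ)) (b := (s : ℝ)))
        (measure_ne_top _ _) (1 : ℝ))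
      (indicatorConstLp 2 (μ := intervalMeasure T) (measurableSet_Ico (a := (0 : ℝ)) (b := (t : ℝ)))
        (measure_ne_top _ _) (1 : ℝ)) = min (s : ℝ) (t : ℝ) := by
  rw [L2.inner_indicatorConstLp_indicatorConstLp, Set.Ico_inter_Ico, max_self, measureReal_def,
    Measure.restrict_apply measurableSet_Ico, Set.inter_eq_left.2, Real.volume_Ico, sub_zero,
    ENNReal.toReal_ofReal (le_min s.2.1 t.2.1)]
  · simp
  · exact fun x hx => ⟨hx.1, (hx.2.le.trans (min_le_left _ _)).trans s.2.2⟩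

/-- Both families have Gram matrix min(s,t). This gives the bound, with constant 1, needed to extend
by density. -/
lemma norm_linearCombination [IsProbabilityMeasure P] (hW : IsBrownianMotionOn W P)
    (c : Set.Icc (0 : ℝ) T →₀ ℝ) :
    ‖Finsupp.linearCombination ℝ (fun t : Set.Icc (0 : ℝ) T => (hW.memLp_two t).toLp (W t)) c‖ =
    ‖Finsupp.linearCombination ℝ (fun t : Set.Icc (0 : ℝ) T =>
      indicatorConstLp 2 (μ := intervalMeasure T) (measurableSet_Ico (a := (0 : ℝ)) (b := (t : ℝ)))
        (measure_ne_top _ _) (1 : ℝ)) c‖ := by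
  rw [← sq_eq_sq₀ (norm_nonneg _) (norm_nonneg _), ← real_inner_self_eq_norm_sq,
    ← real_inner_self_eq_norm_sq, Finsupp.linearCombination_apply, Finsupp.linearCombination_apply,
    Finsupp.sum, Finsupp.sum]
  simp only [sum_inner, inner_sum, real_inner_smul_left, real_inner_smul_right, hW.inner_toLp,
    inner_indicatorConstLp]

lemma wienerIntegral_linearCombination [IsProbabilityMeasure P] (hT : 0 ≤ T)
    (hW : IsBrownianMotionOn W P) (c : Set.Icc (0 : ℝ) T →₀ ℝ) :
    hW.wienerIntegral (Finsupp.linearCombination ℝ (fun t : Set.Icc (0 : ℝ) T =>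
      indicatorConstLp 2 (μ := intervalMeasure T) (measurableSet_Ico (a := (0 : ℝ)) (b := (t : ℝ)))
        (measure_ne_top _ _) (1 : ℝ)) c) =
    Finsupp.linearCombination ℝ (fun t : Set.Icc (0 : ℝ) T => (hW.memLp_two t).toLp (W t)) c :=
  LinearMap.extendOfNorm_eq (denseRange_linearCombination_indicator hT)
    ⟨1, fun x => by rw [one_mul]; exact (hW.norm_linearCombination x).le⟩ c

lemma wienerIntegral_indicator [IsProbabilityMeasure P] (hT : 0 ≤ T)
    (hW : IsBrownianMotionOn W P) (t : Set.Icc (0 : ℝ) T) :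
    hW.wienerIntegral (indicatorConstLp 2 (μ := intervalMeasure T)
      (measurableSet_Ico (a := (0 : ℝ)) (b := (t : ℝ))) (measure_ne_top _ _) (1 : ℝ)) =
    (hW.memLp_two t).toLp (W t) := by
  have h := hW.wienerIntegral_linearCombination hT (Finsupp.single t 1)
  simpa using h

/-- The Wiener isometry. -/
lemma norm_wienerIntegral [IsProbabilityMeasure P] (hT : 0 ≤ T)
    (hW : IsBrownianMotionOn W P) (f : Lp ℝ 2 (intervalMeasure T)) :
    ‖hW.wienerIntegral f‖ = ‖f‖ := by
  induction f using (denseRange_linearCombination_indicator hT).induction_on with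
  | hp => exact isClosed_eq (by fun_prop) (by fun_prop)
  | ih c => rw [hW.wienerIntegral_linearCombination hT, hW.norm_linearCombination]

lemma inner_wienerIntegral [IsProbabilityMeasure P] (hT : 0 ≤ T)
    (hW : IsBrownianMotionOn W P) (f g : Lp ℝ 2 (intervalMeasure T)) :
    inner ℝ (hW.wienerIntegral f) (hW.wienerIntegral g) = inner ℝ f g := by
  rw [real_inner_eq_norm_add_mul_self_sub_norm_mul_self_sub_norm_mul_self_div_two,
    real_inner_eq_norm_add_mul_self_sub_norm_mul_self_sub_norm_mul_self_div_two, ← map_add]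
  simp only [hW.norm_wienerIntegral hT]

lemma toLp_mem_firstChaos (hW : IsBrownianMotionOn W P) {s u : Set.Icc (0 : ℝ) T} (h : s ≤ u) :
    (hW.memLp_two s).toLp (W s) ∈ firstChaos W P u :=
  Submodule.le_topologicalClosure _ (Submodule.subset_span ⟨s, h, MemLp.coeFn_toLp _⟩)

lemma toLp_indicator_indicatorConstLp (s u : Set.Icc (0 : ℝ) T)
    (h : MemLp ((Set.Icc (0 : ℝ) u).indicator (indicatorConstLp 2 (μ := intervalMeasure T)
      (measurableSet_Ico (a := (0 : ℝ)) (b := (s : ℝ))) (measure_ne_top _ _) (1 : ℝ))) 2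
      (intervalMeasure T)) :
    h.toLp _ = indicatorConstLp 2 (μ := intervalMeasure T)
      (measurableSet_Ico (a := (0 : ℝ)) (b := ((min s u : Set.Icc (0 : ℝ) T) : ℝ)))
      (measure_ne_top _ _) (1 : ℝ) := by
  refine Lp.ext ((MemLp.coeFn_toLp h).trans (.trans ?_ (indicatorConstLp_coeFn (p := 2)).symm))
  have hne : ∀ᵐ x ∂(intervalMeasure T), x ≠ (u : ℝ) := ae_restrict_of_ae (Measure.ae_ne volume _)
  filter_upwards [hne, indicatorConstLp_coeFn (p := 2) (μ := intervalMeasure T)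
    (hs := measurableSet_Ico (a := (0 : ℝ)) (b := (s : ℝ))) (hμs := measure_ne_top _ _)
    (c := (1 : ℝ))] with x hx hx'
  have hmin : ((min s u : Set.Icc (0 : ℝ) T) : ℝ) = min (s : ℝ) u :=
    Monotone.map_min (Subtype.mono_coe _)
  have hiff : x ∈ Set.Ico (0 : ℝ) (min s u : Set.Icc (0 : ℝ) T) ↔
      x ∈ Set.Icc (0 : ℝ) u ∧ x ∈ Set.Ico (0 : ℝ) s := by
    rw [hmin, Set.mem_Ico, lt_min_iff]
    exact ⟨fun h => ⟨⟨h.1, h.2.2.le⟩, h.1, h.2.1⟩,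
      fun h => ⟨h.1.1, h.2.2, lt_of_le_of_ne h.1.2 hx⟩⟩
  by_cases h1 : x ∈ Set.Icc (0 : ℝ) u
  · by_cases h2 : x ∈ Set.Ico (0 : ℝ) s
    · rw [Set.indicator_of_mem h1, hx', Set.indicator_of_mem h2,
        Set.indicator_of_mem (hiff.2 ⟨h1, h2⟩)]
    · rw [Set.indicator_of_mem h1, hx', Set.indicator_of_notMem h2,
        Set.indicator_of_notMem fun h => h2 (hiff.1 h).2]
  · rw [Set.indicator_of_notMem h1, Set.indicator_of_notMem fun h => h1 (hiff.1 h).1]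

/-- The Wiener integral over `[0,u]` belongs to the first chaos `H^W_u`. -/
lemma wienerIntegralUpTo_mem_firstChaos [IsProbabilityMeasure P] (hT : 0 ≤ T)
    (hW : IsBrownianMotionOn W P) (u : Set.Icc (0 : ℝ) T) (f : ℝ → ℝ)
    (hf : MemLp f 2 (intervalMeasure T)) :
    hW.wienerIntegralUpTo u f hf ∈ firstChaos W P u := by
  -- Truncation to [0,u] is made a bounded operator, so membership is a closed condition on the
  -- integrand. It then suffices to test 𝟏_[0,s), which truncates to 𝟏_[0,min s u) up to a null set.
  set A : Lp ℝ 2 (intervalMeasure T) → Lp ℝ 2 (intervalMeasure T) := fun g =>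
    ((Lp.memLp g).indicator (measurableSet_Icc (a := (0 : ℝ)) (b := (u : ℝ)))).toLp _ with hA
  have hA_add : ∀ g h, A (g + h) = A g + A h := fun g h => by
    rw [hA, ← MemLp.toLp_add]
    refine MemLp.toLp_congr _ _ ?_
    filter_upwards [Lp.coeFn_add g h] with x hx
    simp only [Set.indicator_apply, Pi.add_apply, hx]
    split_ifs <;> simp
  have hA_smul : ∀ (a : ℝ) g, A (a • g) = a • A g := fun a g => by
    rw [hA, ← MemLp.toLp_const_smul]
    refine MemLp.toLp_congr _ _ ?_
    filter_upwards [Lp.coeFn_smul a g] with x hx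
    simp only [Set.indicator_apply, Pi.smul_apply, hx]
    split_ifs <;> simp
  have hA_norm : ∀ g, ‖A g‖ ≤ 1 * ‖g‖ := fun g => by
    rw [one_mul, hA, Lp.norm_toLp, Lp.norm_def]
    exact ENNReal.toReal_mono (Lp.eLpNorm_ne_top g) (eLpNorm_indicator_le _)
  let B : Lp ℝ 2 (intervalMeasure T) →L[ℝ] Lp ℝ 2 (intervalMeasure T) :=
    LinearMap.mkContinuous ⟨⟨A, hA_add⟩, hA_smul⟩ 1 hA_norm
  have hfB : hW.wienerIntegralUpTo u f hf = hW.wienerIntegral (B (hf.toLp f)) := by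
    change hW.wienerIntegral _ = hW.wienerIntegral (A (hf.toLp f))
    congr 1
    refine MemLp.toLp_congr _ _ ?_
    filter_upwards [hf.coeFn_toLp] with x hx
    by_cases hxu : x ∈ Set.Icc (0 : ℝ) u <;> simp [hxu, hx]
  have hB : ∀ s : Set.Icc (0 : ℝ) T, B (indicatorConstLp 2 (μ := intervalMeasure T)
      (measurableSet_Ico (a := (0 : ℝ)) (b := (s : ℝ))) (measure_ne_top _ _) (1 : ℝ)) =
      indicatorConstLp 2 (μ := intervalMeasure T)
      (measurableSet_Ico (a := (0 : ℝ)) (b := ((min s u : Set.Icc (0 : ℝ) T) : ℝ)))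
      (measure_ne_top _ _) (1 : ℝ) := fun s =>
    toLp_indicator_indicatorConstLp s u ((Lp.memLp _).indicator measurableSet_Icc)
  rw [hfB]
  generalize hf.toLp f = g
  induction g using (denseRange_linearCombination_indicator hT).induction_on with
  | hp =>
    exact (Submodule.isClosed_topologicalClosure _).preimage
      (hW.wienerIntegral.continuous.comp B.continuous)
  | ih c =>
    rw [Finsupp.linearCombination_apply, Finsupp.sum, map_sum, map_sum]
    refine Submodule.sum_mem _ fun s _ => ?_
    rw [map_smul, map_smul, hB, hW.wienerIntegral_indicator hT]
    exact Submodule.smul_mem _ _ (hW.toLp_mem_firstChaos (min_le_right s u))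

/-- The increment of the Wiener integral after `u` is orthogonal to the first chaos `H^W_u`. -/
lemma inner_wienerIntegral_sub_eq_zero [IsProbabilityMeasure P] (hT : 0 ≤ T)
    (hW : IsBrownianMotionOn W P) (u : Set.Icc (0 : ℝ) T) (f : ℝ → ℝ)
    (hf : MemLp f 2 (intervalMeasure T)) {ξ : Lp ℝ 2 P} (hξ : ξ ∈ firstChaos W P u) :
    inner ℝ ξ (hW.wienerIntegral (hf.toLp f) - hW.wienerIntegralUpTo u f hf) = 0 := by
  suffices h : firstChaos W P u ≤
      (ℝ ∙ (hW.wienerIntegral (hf.toLp f) - hW.wienerIntegralUpTo u f hf))ᗮ from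
    Submodule.mem_orthogonal_singleton_iff_inner_left.1 (h hξ)
  refine Submodule.topologicalClosure_minimal _ (Submodule.span_le.2 ?_)
    (Submodule.isClosed_orthogonal _)
  rintro ζ ⟨s, hs, hζ⟩
  have hζ' : ζ = (hW.memLp_two s).toLp (W s) := Lp.ext (hζ.trans (MemLp.coeFn_toLp _).symm)
  rw [SetLike.mem_coe, Submodule.mem_orthogonal_singleton_iff_inner_left, hζ',
    ← hW.wienerIntegral_indicator hT, wienerIntegralUpTo, ← map_sub, hW.inner_wienerIntegral hT,
    L2.inner_indicatorConstLp_one, ← MemLp.toLp_sub]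
  -- The isometry has reduced the claim to the integral over [0,s) of f - 𝟏_[0,u] f, which vanishes
  -- there because s ≤ u.
  refine setIntegral_eq_zero_of_ae_eq_zero ?_
  filter_upwards [MemLp.coeFn_toLp (hf.sub (hf.indicator
    (measurableSet_Icc (a := (0 : ℝ)) (b := (u : ℝ)))))] with x hx hxs
  rw [hx, Pi.sub_apply, Set.indicator_of_mem, sub_self]
  exact ⟨hxs.1, hxs.2.le.trans hs⟩

end IsBrownianMotionOn

/-! ### First chaos and conditional expectation. -/

section Chaos

variable {P : Measure Ω} {X : Set.Icc (0 : ℝ) T → Ω → ℝ}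

lemma firstChaos_mono {s t : Set.Icc (0 : ℝ) T} (h : s ≤ t) : firstChaos X P s ≤ firstChaos X P t :=
  Submodule.topologicalClosure_mono <| Submodule.span_mono fun _ ⟨r, hr, hξ⟩ => ⟨r, hr.trans h, hξ⟩

lemma isGaussianSubspace_firstChaos [IsProbabilityMeasure P] (hX : IsGaussianProcess X P)
    (hX0 : ∀ t, ∫ ω, X t ω ∂P = 0) (t : Set.Icc (0 : ℝ) T) :
    IsGaussianSubspace (firstChaos X P t) :=
  (isGaussianSubspace_span hX hX0 (Set.Iic t)).topologicalClosure

lemma sigmaUpTo_le (hX : ∀ t, Measurable (X t)) (u : Set.Icc (0 : ℝ) T) : sigmaUpTo X u ≤ mΩ :=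
  iSup₂_le fun s _ => (hX s).comap_le

/-- The L² variables with a version measurable for the smaller σ-algebra form a closed subspace
containing each X_s, s ≤ u. -/
lemma aestronglyMeasurable_of_mem_firstChaos (hX : ∀ t, Measurable (X t))
    {u : Set.Icc (0 : ℝ) T} {ξ : Lp ℝ 2 P} (hξ : ξ ∈ firstChaos X P u) :
    AEStronglyMeasurable[sigmaUpTo X u] ξ P := by
  suffices h : firstChaos X P u ≤ lpMeas ℝ ℝ (sigmaUpTo X u) 2 P from
    mem_lpMeas_iff_aestronglyMeasurable.1 (h hξ)
  refine Submodule.topologicalClosure_minimal _ (Submodule.span_le.2 ?_)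
    (isClosed_aestronglyMeasurable (sigmaUpTo_le hX u))
  rintro ζ ⟨s, hs, hζ⟩
  refine mem_lpMeas_iff_aestronglyMeasurable.2 ⟨X s, ?_, hζ⟩
  have hm : Measurable[sigmaUpTo X u] (X s) :=
    Measurable.mono (comap_measurable (X s))
      (le_iSup₂ (f := fun r (_ : r ∈ Set.Iic u) => MeasurableSpace.comap (X r) inferInstance) s hs)
      le_rfl
  exact hm.stronglyMeasurable

/-- A random variable in the Gaussian space of `X` that is orthogonal to `H^X_u` has vanishing
conditional expectation given `σ(X_s : s ∈ [0,u])`. -/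
lemma condExp_sigmaUpTo_eq_zero [IsProbabilityMeasure P] (hX_meas : ∀ t, Measurable (X t))
    (hX : IsGaussianProcess X P)
    (hX0 : ∀ t, ∫ ω, X t ω ∂P = 0) {u v : Set.Icc (0 : ℝ) T} (huv : u ≤ v) {η : Lp ℝ 2 P}
    (hη : η ∈ firstChaos X P v) (horth : ∀ ξ ∈ firstChaos X P u, inner ℝ ξ η = 0) :
    P[η | sigmaUpTo X u] =ᵐ[P] 0 := by
  -- The later time v is used because this Gaussian space contains both η and all X_s with s ≤ u.
  have hH := isGaussianSubspace_firstChaos hX hX0 v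
  have hmem : ∀ s : Set.Iic u, (hX.hasGaussianLaw_eval s).memLp_two.toLp (X s) ∈ firstChaos X P u :=
    fun s => Submodule.le_topologicalClosure _
      (Submodule.subset_span ⟨s, s.2, MemLp.coeFn_toLp _⟩)
  have hind := hH.indepFun_of_inner_eq_zero (Y := fun _ : Unit => η)
    (Z := fun s : Set.Iic u => X s) (η := fun _ => η)
    (ζ := fun s : Set.Iic u => (hX.hasGaussianLaw_eval s).memLp_two.toLp (X s))
    (fun _ => hη) (fun s => firstChaos_mono huv (hmem s)) (fun _ => .rfl)
    (fun s => (MemLp.coeFn_toLp _).symm)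
    (fun _ s => by rw [real_inner_comm]; exact horth _ (hmem s))
  have hind' : IndepFun η (fun ω (s : Set.Iic u) => X s ω) P :=
    hind.comp (measurable_pi_apply ()) measurable_id
  have hle : sigmaUpTo X u ≤
      MeasurableSpace.comap (fun ω (s : Set.Iic u) => X s ω) inferInstance :=
    iSup₂_le fun s hs => by
      have hm : Measurable[MeasurableSpace.comap (fun ω (s : Set.Iic u) => X s ω) inferInstance]
          (X s) :=
        (measurable_pi_apply (⟨s, hs⟩ : Set.Iic u)).comp
          (comap_measurable fun ω (s : Set.Iic u) => X s ω)
      exact hm.comap_le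
  have hηm : Measurable η := (Lp.stronglyMeasurable η).measurable
  have h := condExp_indep_eq hηm.comap_le (sigmaUpTo_le hX_meas u)
    (comap_measurable (η : Ω → ℝ)).stronglyMeasurable
    (indep_of_indep_of_le_right hind' hle)
  rw [hH.centered η hη] at h
  exact h

end Chaos

end

theorem mainTheorem5 {Ω : Type*} [mΩ : MeasurableSpace Ω] (P : Measure Ω) [IsProbabilityMeasure P]
    (T : ℝ) (X W : Set.Icc (0 : ℝ) T → Ω → ℝ) (K : ℝ → ℝ → ℝ)
    -- `X` is a centered Gaussian process with uniformly bounded variance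
    (hX_meas : ∀ t, Measurable (X t))
    (hX_gauss : IsGaussianProcess X P)
    (hX_centered : ∀ t, ∫ ω, X t ω ∂P = 0)
    (hX_var : ∃ C : ℝ, ∀ t, ∫ ω, X t ω ^ 2 ∂P ≤ C)
    -- `X t = ∫_0^T K(t,s) dW_s` almost surely, with `W` a Brownian motion and `K ∈ L²([0,T]²)`
    (hW : IsBrownianMotionOn W P)
    (hK : MemLp (fun p : ℝ × ℝ => K p.1 p.2) 2
      (volume.restrict (Set.Icc 0 T ×ˢ Set.Icc 0 T)))
    (hKt : ∀ t : Set.Icc (0 : ℝ) T, MemLp (K t) 2 (intervalMeasure T))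
    (hXW : ∀ t : Set.Icc (0 : ℝ) T, X t =ᵐ[P] hW.wienerIntegral ((hKt t).toLp (K t)))
    -- `H^X_t = H^W_t` for all `t ∈ [0,T]`
    (hchaos : ∀ t, firstChaos X P t = firstChaos W P t)
    (tU t : Set.Icc (0 : ℝ) T) (htU : 0 < (tU : ℝ)) (ht : tU < t) :
    P[X t | sigmaUpTo X tU] =ᵐ[P] hW.wienerIntegralUpTo tU (K t) (hKt t) := by
  have hT : 0 ≤ T := tU.2.1.trans tU.2.2
  set ξ := hW.wienerIntegralUpTo tU (K t) (hKt t) with hξ_def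
  set η := hW.wienerIntegral ((hKt t).toLp (K t)) - ξ with hη_def
  have hξ : ξ ∈ firstChaos X P tU := by
    rw [hchaos]
    exact hW.wienerIntegralUpTo_mem_firstChaos hT tU (K t) (hKt t)
  have hη : η ∈ firstChaos X P t := by
    refine Submodule.sub_mem _ (Submodule.le_topologicalClosure _ (Submodule.subset_span ?_))
      (firstChaos_mono ht.le hξ)
    exact ⟨t, le_rfl, (hXW t).symm⟩
  -- Orthogonality is known against the past of W; equality of the chaoses turns it into
  -- orthogonality against the past of X.
  have horth : ∀ ζ ∈ firstChaos X P tU, inner ℝ ζ η = 0 := fun ζ hζ => by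
    rw [hchaos] at hζ
    exact hW.inner_wienerIntegral_sub_eq_zero hT tU (K t) (hKt t) hζ
  have hsum : X t =ᵐ[P] (ξ : Ω → ℝ) + (η : Ω → ℝ) := by
    refine (hXW t).trans ?_
    rw [← add_sub_cancel ξ (hW.wienerIntegral ((hKt t).toLp (K t))), ← hη_def]
    exact Lp.coeFn_add ξ η
  have hint : ∀ ζ : Lp ℝ 2 P, Integrable ζ P := fun ζ => (Lp.memLp ζ).integrable (by norm_num)
  have hle := sigmaUpTo_le hX_meas tU
  filter_upwards [condExp_congr_ae (m := sigmaUpTo X tU) hsum,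
    condExp_add (hint ξ) (hint η) (sigmaUpTo X tU),
    condExp_of_aestronglyMeasurable' hle (aestronglyMeasurable_of_mem_firstChaos hX_meas hξ)
      (hint ξ),
    condExp_sigmaUpTo_eq_zero hX_meas hX_gauss hX_centered ht.le hη horth] with ω h1 h2 h3 h4
  rw [h1, h2, Pi.add_apply, h3, h4, Pi.zero_apply, add_zero]
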